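/- Let $0<\alpha<1$, $q_1>0$ and $\lambda>0$ be constants, and let $$\partial_t^\alpha\varphi(t)=\frac1{\Gamma(1-\alpha)}\int_0^t(t-\tau)^{-\alpha}\varphi'(\tau)\,d\tau$$ be the Caputo derivative of order $\alpha$. For $v_0\in\mathbb R$ consider the problem $$v'(t)+q_1\,\partial_t^\alpha v(t)+\lambda v(t)=0\quad(t>0),\qquad v(0)=v_0,\tag{P}$$ where a solution is a function $v:[0,\infty)\to\mathbb R$ that is absolutely continuous on $[0,T]$ for every $T>0$, satisfies $v(0)=v_0$, and satisfies the equation for almost every $t>0$. For every $v_0\in\mathbb R$ problem (P) has exactly one solution $v$. Moreover, for every $t_0>0$ there are constants $c>0$ and $C>0$, depending only on $\alpha,q_1,\lambda$ and $t_0$, such that for every $v_0\in\mathbb R$ the solution $v$ of (P) satisfies $$c\,|v_0|\,t^{-\alpha}\le|v(t)|\le C\,|v_0|\,t^{-\alpha}\qquad\text{for all }t\ge t_0 .$$ In particular, for $v_0\neq0$ the decay order $\alpha$ is sharp. -/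

import Mathlib

open MeasureTheory Set

noncomputable section

/-- The Caputo fractional derivative of order `α ∈ (0,1)` with base point `0`:
`(1 / Γ(1 - α)) ∫₀ᵗ (t - τ)^(-α) φ'(τ) dτ`. -/
def caputoDeriv (α : ℝ) (φ : ℝ → ℝ) (t : ℝ) : ℝ :=
  (1 / Real.Gamma (1 - α)) * ∫ τ in (0 : ℝ)..t, (t - τ) ^ (-α) * deriv φ τ

/-- `v` solves `v' + q₁ ∂ₜ^α v + lam v = 0` for `t > 0` with `v(0) = v₀`. The solution class is
that of the functions which are absolutely continuous on `[0, T]` for every `T > 0`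
(that is, which lie in `W^{1,1}(0, T)`; this contains `H^1(0, T)` and `C^1[0, T]`); for those `v'`
and the Caputo integral exist at almost every `t > 0`, and the equation is required there. -/
structure IsFracODESolution (α q₁ lam v₀ : ℝ) (v : ℝ → ℝ) : Prop where
  absCont : ∀ T : ℝ, 0 < T → AbsolutelyContinuousOnInterval v 0 T
  equation : ∀ᵐ t ∂(volume.restrict (Ioi (0 : ℝ))),
    deriv v t + q₁ * caputoDeriv α v t + lam * v t = 0
  initial : v 0 = v₀

end

/-! By linearity it suffices to treat `v₀ = 1`. Writing `u = -v'` and `V = 1 - ∫₀ᵗ u`, the problem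
becomes the Volterra equation `u + a * u = lam` with `a(s) = κ s^(-α) + lam` and `κ = q₁ / Γ(1 -
α)`. A weight `exp (-σ s)` with large `σ` makes the `L¹` norm of `a` less than one. This gives a
continuous `u` by contraction (`exists_continuous_volterra`), and uniqueness among absolutely
continuous functions, since the difference of two derivatives is dominated by its own convolution
(`ae_eq_zero_of_le_volterra`).

Because `a` is nonnegative and nonincreasing, `u > 0` (`volterra_pos`), so `V` decreases. The decay
(`relaxation_bounds`) then follows from `u + κ s^(-α) * u = lam V`. Bounding `(t - s)^(-α)` below by
`t^(-α)` gives the lower estimate. Integrating over `(0, t)`, with Young's inequality, `∫ u ≤ 1` and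
`t V(t) ≤ ∫ V`, gives the upper one. -/

/-! ### Convolution inequalities and exponential weights -/

/-- Young's inequality for the convolution of nonnegative functions on `(0, T]`. -/
theorem lintegral_volterra_le {K f : ℝ → ENNReal} (hK : Measurable K) (hf : Measurable f) (T : ℝ) :
    ∫⁻ t in Ioc 0 T, ∫⁻ s in Ioc 0 t, K (t - s) * f s ≤
      (∫⁻ s in Ioc 0 T, K s) * ∫⁻ s in Ioc 0 T, f s := by
  -- The interval is closed at `0` because `t - s = 0` occurs at `s = t`.
  set K' := (Icc 0 T).indicator K with hK'
  set f' := (Ioc 0 T).indicator f with hf'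
  have mK : Measurable K' := hK.indicator measurableSet_Icc
  have mf : Measurable f' := hf.indicator measurableSet_Ioc
  have h1 : ∀ t ∈ Ioc 0 T, ∫⁻ s in Ioc 0 t, K (t - s) * f s ≤ ∫⁻ s, K' (t - s) * f' s := by
    intro t ht
    refine le_trans (le_of_eq ?_) (setLIntegral_le_lintegral (Ioc 0 t) _)
    refine setLIntegral_congr_fun measurableSet_Ioc fun s hs => ?_
    have e1 : t - s ∈ Icc 0 T := ⟨by linarith [hs.2], by linarith [hs.1, ht.2]⟩
    have e2 : s ∈ Ioc 0 T := ⟨hs.1, hs.2.trans ht.2⟩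
    simp [hK', hf', e1, e2]
  calc _ ≤ ∫⁻ t in Ioc 0 T, ∫⁻ s, K' (t - s) * f' s := setLIntegral_mono' measurableSet_Ioc h1
    _ ≤ ∫⁻ t, ∫⁻ s, K' (t - s) * f' s := setLIntegral_le_lintegral _ _
    _ = ∫⁻ s, ∫⁻ t, K' (t - s) * f' s := by
        refine lintegral_lintegral_swap ?_
        exact ((mK.comp (measurable_fst.sub measurable_snd)).mul
          (mf.comp measurable_snd)).aemeasurable
    _ = ∫⁻ s, (∫⁻ t, K' t) * f' s := by
        refine lintegral_congr fun s => ?_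
        rw [lintegral_mul_const _ (show Measurable fun t => K' (t - s) from
            mK.comp (measurable_id.sub_const s)),
          lintegral_sub_right_eq_self K' s]
    _ = (∫⁻ t, K' t) * ∫⁻ s, f' s := lintegral_const_mul _ mf
    _ = _ := by
        rw [hK', hf', lintegral_indicator measurableSet_Icc, lintegral_indicator measurableSet_Ioc,
          setLIntegral_congr Ioc_ae_eq_Icc.symm]

/-- A function that is integrable on `(0, T]` and bounded by its own convolution with a kernel `K`
vanishes, provided that a weighted `L¹` norm of `K` is less than one. -/
theorem ae_eq_zero_of_le_volterra {K f : ℝ → ENNReal} (hK : Measurable K) (hf : Measurable f)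
    {T σ : ℝ} (hfin : ∫⁻ s in Ioc 0 T, f s ≠ ⊤) (hσ : 0 ≤ σ)
    (hsmall : ∫⁻ s in Ioc 0 T, ENNReal.ofReal (Real.exp (-σ * s)) * K s < 1)
    (hle : ∀ᵐ t ∂volume.restrict (Ioc 0 T), f t ≤ ∫⁻ s in Ioc 0 t, K (t - s) * f s) :
    ∀ᵐ t ∂volume.restrict (Ioc 0 T), f t = 0 := by
  set e : ℝ → ENNReal := fun s => ENNReal.ofReal (Real.exp (-σ * s)) with he
  have me : Measurable e := by fun_prop
  have hI : ∫⁻ t in Ioc 0 T, e t * f t ≤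
      (∫⁻ s in Ioc 0 T, e s * K s) * ∫⁻ s in Ioc 0 T, e s * f s := by
    refine le_trans (lintegral_mono_ae ?_) (lintegral_volterra_le (me.mul hK) (me.mul hf) T)
    filter_upwards [hle] with t ht
    calc e t * f t ≤ e t * ∫⁻ s in Ioc 0 t, K (t - s) * f s := by gcongr
      _ = ∫⁻ s in Ioc 0 t, e t * (K (t - s) * f s) := by
          rw [lintegral_const_mul]
          exact (hK.comp (measurable_const.sub measurable_id)).mul hf
      _ = _ := by
          refine lintegral_congr fun s => ?_
          -- Multiplicativity of the weight lets it pass inside the convolution.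
          have : e t = e (t - s) * e s := by
            simp only [he]
            rw [← ENNReal.ofReal_mul (Real.exp_pos _).le, ← Real.exp_add]
            congr 2; ring
          rw [this]; simp only [Pi.mul_apply]; ring
  have hfin' : ∫⁻ t in Ioc 0 T, e t * f t ≠ ⊤ := by
    refine ne_top_of_le_ne_top hfin (setLIntegral_mono' measurableSet_Ioc fun t ht => ?_)
    refine mul_le_of_le_one_left' ?_
    simp only [he]
    rw [ENNReal.ofReal_le_one, Real.exp_le_one_iff]
    nlinarith [ht.1]
  -- A finite nonzero `I` cannot satisfy `I ≤ q I` with `q < 1`.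
  have h0 : ∫⁻ t in Ioc 0 T, e t * f t = 0 := by
    by_contra hne
    have := ENNReal.mul_lt_mul_left hne hfin' hsmall
    rw [one_mul] at this
    exact absurd hI (not_le.mpr this)
  filter_upwards [(lintegral_eq_zero_iff (me.mul hf)).mp h0] with t ht
  have : e t ≠ 0 := by simp [he, Real.exp_pos]
  simpa [this] using ht

/-- If `exp (-s) * a s` is integrable on `(0, ∞)`, then large exponential weights make the
`L¹` norm of `a` small. -/
theorem exists_exp_weight_lt_one {a : ℝ → ℝ}
    (ha : IntegrableOn (fun s => Real.exp (-s) * a s) (Ioi 0)) :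
    ∃ σ : ℝ, 0 ≤ σ ∧ IntegrableOn (fun s => Real.exp (-σ * s) * a s) (Ioi 0) ∧
      ∫ s in Ioi 0, ‖Real.exp (-σ * s) * a s‖ < 1 := by
  -- The exponent `n + 1` leaves one factor `exp (-s)`, so the hypothesis supplies the dominating
  -- function.
  have key : ∀ n : ℕ, ∀ s : ℝ, Real.exp (-((n : ℝ) + 1) * s) * a s =
      Real.exp (-(n : ℝ) * s) * (Real.exp (-s) * a s) := by
    intro n s
    rw [← mul_assoc, ← Real.exp_add]; congr 2; ring
  have hbd : ∀ n : ℕ, ∀ s ∈ Ioi (0 : ℝ), ‖Real.exp (-((n : ℝ) + 1) * s) * a s‖ ≤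
      ‖Real.exp (-s) * a s‖ := by
    intro n s hs
    rw [key, norm_mul]
    refine mul_le_of_le_one_left (norm_nonneg _) ?_
    rw [Real.norm_of_nonneg (Real.exp_pos _).le, Real.exp_le_one_iff]
    have : (0 : ℝ) ≤ n := n.cast_nonneg
    have : (0 : ℝ) < s := hs
    nlinarith [mul_nonneg n.cast_nonneg this.le]
  have hmeas : ∀ n : ℕ, AEStronglyMeasurable (fun s => Real.exp (-((n : ℝ) + 1) * s) * a s)
      (volume.restrict (Ioi 0)) := by
    intro n
    simp_rw [key]
    exact (Continuous.aestronglyMeasurable (by fun_prop)).mul ha.aestronglyMeasurable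
  have hint : ∀ n : ℕ, IntegrableOn (fun s => Real.exp (-((n : ℝ) + 1) * s) * a s) (Ioi 0) := by
    intro n
    refine Integrable.mono ha (hmeas n) ?_
    filter_upwards [ae_restrict_mem measurableSet_Ioi] with s hs using hbd n s hs
  have hlim : Filter.Tendsto
      (fun n : ℕ => ∫ s in Ioi 0, ‖Real.exp (-((n : ℝ) + 1) * s) * a s‖) Filter.atTop
      (nhds (∫ s in Ioi (0 : ℝ), (0 : ℝ))) := by
    refine tendsto_integral_of_dominated_convergence _ (fun n => (hmeas n).norm) ha.norm ?_ ?_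
    · intro n
      filter_upwards [ae_restrict_mem measurableSet_Ioi] with s hs
      rw [norm_norm]; exact hbd n s hs
    · filter_upwards [ae_restrict_mem measurableSet_Ioi] with s hs
      have h1 : Filter.Tendsto (fun n : ℕ => Real.exp (-(n : ℝ) * s)) Filter.atTop (nhds 0) := by
        refine Real.tendsto_exp_atBot.comp ?_
        exact (Filter.tendsto_neg_atTop_atBot.comp
          tendsto_natCast_atTop_atTop).atBot_mul_const hs
      have h2 := (h1.mul_const (Real.exp (-s) * a s)).norm
      simp only [zero_mul, norm_zero] at h2
      simpa only [key] using h2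
  rw [integral_zero] at hlim
  obtain ⟨n, hn⟩ := (hlim.eventually (gt_mem_nhds one_pos)).exists
  exact ⟨n + 1, by positivity, hint n, hn⟩

/-! ### Existence for Volterra equations by contraction -/

/-- The convolution of an integrable function with a bounded continuous one is continuous. -/
theorem continuous_volterra {b : ℝ → ℝ} (hb : IntegrableOn b (Ioi 0))
    (U : BoundedContinuousFunction ℝ ℝ) :
    Continuous fun t => ∫ s in Ioi 0, (Iio t).indicator (fun s => b s * U (t - s)) s := by
  rw [continuous_iff_continuousAt]
  intro t₀
  refine continuousAt_of_dominated (bound := fun s => ‖b s‖ * ‖U‖) ?_ ?_ (hb.norm.mul_const _) ?_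
  · refine Filter.Eventually.of_forall fun t => ?_
    refine AEStronglyMeasurable.indicator ?_ measurableSet_Iio
    exact hb.aestronglyMeasurable.mul (Continuous.aestronglyMeasurable (by fun_prop))
  · refine Filter.Eventually.of_forall fun t => Filter.Eventually.of_forall fun s => ?_
    refine (norm_indicator_le_norm_self _ _).trans ?_
    rw [norm_mul]
    gcongr
    exact U.norm_coe_le_norm _
  -- The moving endpoint is encoded in the indicator, whose only jump at `t₀` is the null set `s =
  -- t₀`.
  · have hne : ∀ᵐ s ∂volume.restrict (Ioi (0 : ℝ)), s ≠ t₀ :=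
      ae_restrict_of_ae (Measure.ae_ne volume t₀)
    filter_upwards [hne] with s hs
    rcases lt_or_gt_of_ne hs with h | h
    · have : (fun t => b s * U (t - s)) =ᶠ[nhds t₀]
          fun t => (Iio t).indicator (fun s => b s * U (t - s)) s := by
        filter_upwards [lt_mem_nhds h] with t ht
        simp [indicator, ht]
      refine ContinuousAt.congr ?_ this
      exact Continuous.continuousAt (by fun_prop)
    · have : (fun _ => (0 : ℝ)) =ᶠ[nhds t₀]
          fun t => (Iio t).indicator (fun s => b s * U (t - s)) s := by
        filter_upwards [gt_mem_nhds h] with t ht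
        simp [indicator, ht.le]
      exact continuousAt_const.congr this

/-- This bound serves twice: the convolution stays bounded, and its Lipschitz constant is the `L¹`
norm of `b`. -/
theorem norm_volterra_le {b : ℝ → ℝ} (hb : IntegrableOn b (Ioi 0))
    (U : BoundedContinuousFunction ℝ ℝ) (t : ℝ) :
    ‖∫ s in Ioi 0, (Iio t).indicator (fun s => b s * U (t - s)) s‖ ≤
      (∫ s in Ioi 0, ‖b s‖) * ‖U‖ := by
  rw [← integral_mul_const]
  refine norm_integral_le_of_norm_le (hb.norm.mul_const _) (Filter.Eventually.of_forall fun s => ?_)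
  refine (norm_indicator_le_norm_self _ _).trans ?_
  rw [norm_mul]
  gcongr
  exact U.norm_coe_le_norm _

theorem integrable_volterra {b : ℝ → ℝ} (hb : IntegrableOn b (Ioi 0))
    (U : BoundedContinuousFunction ℝ ℝ) (t : ℝ) :
    IntegrableOn ((Iio t).indicator fun s => b s * U (t - s)) (Ioi 0) := by
  refine Integrable.indicator ?_ measurableSet_Iio
  refine Integrable.mul_bdd (c := ‖U‖) hb (Continuous.aestronglyMeasurable (by fun_prop)) ?_
  exact Filter.Eventually.of_forall fun s => U.norm_coe_le_norm _

/-- A Volterra equation whose kernel has `L¹` norm less than one has a bounded solution. -/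
theorem exists_boundedContinuous_volterra {b : ℝ → ℝ} (hb : IntegrableOn b (Ioi 0))
    (hb1 : ∫ s in Ioi 0, ‖b s‖ < 1) (g : BoundedContinuousFunction ℝ ℝ) :
    ∃ U : BoundedContinuousFunction ℝ ℝ, ∀ t, 0 ≤ t →
      U t = g t - ∫ s in (0 : ℝ)..t, b s * U (t - s) := by
  set k : ℝ := ∫ s in Ioi 0, ‖b s‖ with hk
  have k0 : 0 ≤ k := integral_nonneg fun s => norm_nonneg _
  let A : BoundedContinuousFunction ℝ ℝ → BoundedContinuousFunction ℝ ℝ := fun U =>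
    BoundedContinuousFunction.ofNormedAddCommGroup _ (continuous_volterra hb U) (k * ‖U‖)
      (norm_volterra_le hb U)
  have hA : ∀ U W, dist (g - A U) (g - A W) ≤ k * dist U W := by
    intro U W
    rw [dist_eq_norm, dist_eq_norm]
    refine (BoundedContinuousFunction.norm_le (by positivity)).mpr fun t => ?_
    have : (g - A U - (g - A W)) t =
        -∫ s in Ioi 0, (Iio t).indicator (fun s => b s * (U - W) (t - s)) s := by
      change g t - (∫ s in Ioi 0, (Iio t).indicator (fun s => b s * U (t - s)) s) -
        (g t - ∫ s in Ioi 0, (Iio t).indicator (fun s => b s * W (t - s)) s) = _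
      rw [sub_sub_sub_cancel_left, ← neg_sub, neg_inj,
        ← integral_sub (integrable_volterra hb U t) (integrable_volterra hb W t)]
      congr 1
      ext s
      by_cases hs : s < t <;> simp [indicator, hs, mul_sub]
    rw [this, norm_neg]
    exact norm_volterra_le hb _ t
  have hc : ContractingWith ⟨k, k0⟩ fun U => g - A U :=
    ⟨by exact_mod_cast hb1, LipschitzWith.of_dist_le_mul hA⟩
  refine ⟨hc.fixedPoint, fun t ht => ?_⟩
  set U := hc.fixedPoint
  have h1 : g - A U = U := hc.fixedPoint_isFixedPt
  have h2 : U t = g t - ∫ s in Ioi 0, (Iio t).indicator (fun s => b s * U (t - s)) s := by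
    conv_lhs => rw [← h1]
    rfl
  rw [h2, setIntegral_indicator measurableSet_Iio, intervalIntegral.integral_of_le ht,
    Ioi_inter_Iio, integral_Ioc_eq_integral_Ioo]

/-- A linear Volterra equation with constant right-hand side has a continuous solution. -/
theorem exists_continuous_volterra {a : ℝ → ℝ}
    (ha : IntegrableOn (fun s => Real.exp (-s) * a s) (Ioi 0)) (c : ℝ) :
    ∃ u : ℝ → ℝ, Continuous u ∧ ∀ t, 0 ≤ t → u t + ∫ s in (0 : ℝ)..t, a (t - s) * u s = c := by
  obtain ⟨σ, hσ, hint, hlt⟩ := exists_exp_weight_lt_one ha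
  -- The unknown is `U = exp (-σ t) u`; the absolute value keeps the weighted right-hand side
  -- bounded on all of `ℝ`.
  have hg : ∀ t : ℝ, ‖c * Real.exp (-σ * |t|)‖ ≤ |c| := by
    intro t
    rw [norm_mul, Real.norm_of_nonneg (Real.exp_pos _).le, Real.norm_eq_abs]
    refine mul_le_of_le_one_right (abs_nonneg c) (Real.exp_le_one_iff.mpr ?_)
    nlinarith [abs_nonneg t, mul_nonneg hσ (abs_nonneg t)]
  obtain ⟨U, hU⟩ := exists_boundedContinuous_volterra hint hlt
    (BoundedContinuousFunction.ofNormedAddCommGroup (fun t : ℝ => c * Real.exp (-σ * |t|))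
      (by fun_prop) |c| hg)
  refine ⟨fun t => Real.exp (σ * t) * U t, by fun_prop, fun t ht => ?_⟩
  have h1 : ∫ s in (0 : ℝ)..t, a (t - s) * (Real.exp (σ * s) * U s) =
      Real.exp (σ * t) * ∫ s in (0 : ℝ)..t, Real.exp (-σ * s) * a s * U (t - s) := by
    have := intervalIntegral.integral_comp_sub_left (a := 0) (b := t)
      (fun s => a s * (Real.exp (σ * (t - s)) * U (t - s))) t
    simp only [sub_sub_cancel, sub_self, sub_zero] at this
    rw [this, ← intervalIntegral.integral_const_mul]
    congr 1
    ext s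
    have : Real.exp (σ * (t - s)) = Real.exp (σ * t) * Real.exp (-σ * s) := by
      rw [← Real.exp_add]; congr 1; ring
    rw [this]; ring
  have h2 := hU t ht
  rw [BoundedContinuousFunction.coe_ofNormedAddCommGroup, abs_of_nonneg ht] at h2
  have h3 : Real.exp (σ * t) * Real.exp (-σ * t) = 1 := by
    rw [← Real.exp_add]; simp
  change Real.exp (σ * t) * U t + ∫ s in (0 : ℝ)..t, a (t - s) * (Real.exp (σ * s) * U s) = c
  rw [h1]
  linear_combination Real.exp (σ * t) * h2 + c * h3

/-! ### Positivity for monotone kernels -/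

theorem intervalIntegrable_volterra {a u : ℝ → ℝ}
    (ha : ∀ x y, IntervalIntegrable a volume x y) (hu : Continuous u) (t x y : ℝ) :
    IntervalIntegrable (fun s => a (t - s) * u s) volume x y := by
  refine IntervalIntegrable.mul_continuousOn ?_ hu.continuousOn
  simpa using (ha (t - x) (t - y)).comp_sub_left t

/-- The solution of a Volterra equation with nonnegative nonincreasing kernel and positive
constant right-hand side is positive. -/
theorem volterra_pos {a u : ℝ → ℝ} (ha : ∀ x y, IntervalIntegrable a volume x y)
    (hanti : AntitoneOn a (Ioi 0)) (ha0 : ∀ s, 0 < s → 0 ≤ a s) (hu : Continuous u) {c : ℝ}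
    (hc : 0 < c) (h : ∀ t, 0 ≤ t → u t + ∫ s in (0 : ℝ)..t, a (t - s) * u s = c)
    {t : ℝ} (ht : 0 ≤ t) : 0 < u t := by
  by_contra hneg
  have hu0 : u 0 = c := by simpa using h 0 le_rfl
  set S := Icc 0 t ∩ u ⁻¹' Iic 0
  have hScpt : IsCompact S := isCompact_Icc.inter_right (isClosed_Iic.preimage hu)
  obtain ⟨t₁, ht₁, hmin⟩ := hScpt.exists_isLeast ⟨t, ⟨ht, le_rfl⟩, not_lt.mp hneg⟩
  have hut₁ : u t₁ ≤ 0 := ht₁.2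
  have hpos : ∀ s, 0 ≤ s → s < t₁ → 0 < u s := by
    intro s hs hst
    by_contra hns
    exact absurd (hmin ⟨⟨hs, hst.le.trans ht₁.1.2⟩, not_lt.mp hns⟩) (not_le.mpr hst)
  have ht₁0 : 0 < t₁ := by
    rcases ht₁.1.1.lt_or_eq with h' | h'
    · exact h'
    · rw [← h', hu0] at hut₁; linarith
  have hcont : Continuous fun x => ∫ s in (0 : ℝ)..x, a s :=
    intervalIntegral.continuous_primitive ha 0
  obtain ⟨δ, hδ, hδ0, hδt⟩ : ∃ δ, ∫ s in (0 : ℝ)..δ, a s < 1 ∧ 0 < δ ∧ δ < t₁ := by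
    have h1 : ∀ᶠ x in nhdsWithin (0 : ℝ) (Ioi 0), ∫ s in (0 : ℝ)..x, a s < 1 := by
      refine (hcont.continuousAt.eventually (gt_mem_nhds ?_)).filter_mono nhdsWithin_le_nhds
      simp
    exact (h1.and (Ioo_mem_nhdsGT ht₁0)).exists
  -- Compare the equation at the first zero `t₁` and at a maximum point `m` just before it. On `(0,
  -- m)` monotonicity of `a` gives a smaller integral at `t₁`; on `(m, t₁)` the integral is at most
  -- `(∫₀^δ a) u(m) < u(m)`. Both sides cannot then equal `c`.
  obtain ⟨m, hm, hmax⟩ := isCompact_Icc.exists_isMaxOn (s := Icc (t₁ - δ) t₁)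
    ⟨t₁ - δ, le_rfl, by linarith⟩ hu.continuousOn
  have hum : 0 < u m := (hpos (t₁ - δ) (by linarith) (by linarith)).trans_le
    (hmax ⟨le_rfl, by linarith⟩)
  have hm1 : m < t₁ := by
    refine lt_of_le_of_ne hm.2 fun e => ?_
    rw [e] at hum; linarith
  have hm0 : 0 ≤ m := by linarith [hm.1]
  have hII := intervalIntegrable_volterra ha hu
  have e1 : ∫ s in (0 : ℝ)..m, a (t₁ - s) * u s ≤ ∫ s in (0 : ℝ)..m, a (m - s) * u s := by
    refine intervalIntegral.integral_mono_on_of_le_Ioo hm0 (hII _ _ _) (hII _ _ _) fun s hs => ?_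
    refine mul_le_mul_of_nonneg_right ?_ (hpos s hs.1.le (hs.2.trans hm1)).le
    exact hanti (sub_pos.mpr hs.2) (sub_pos.mpr (hs.2.trans hm1)) (by linarith)
  have hsub : IntervalIntegrable (fun s => a (t₁ - s)) volume m t₁ := by
    simpa using (ha (t₁ - m) (t₁ - t₁)).comp_sub_left t₁
  have e2 : ∫ s in m..t₁, a (t₁ - s) * u s ≤ (∫ s in m..t₁, a (t₁ - s)) * u m := by
    rw [← intervalIntegral.integral_mul_const]
    refine intervalIntegral.integral_mono_on_of_le_Ioo hm1.le (hII _ _ _)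
      (hsub.mul_const _) fun s hs => ?_
    exact mul_le_mul_of_nonneg_left (hmax ⟨hm.1.trans hs.1.le, hs.2.le⟩)
      (ha0 _ (sub_pos.mpr hs.2))
  have e3 : ∫ s in m..t₁, a (t₁ - s) ≤ ∫ s in (0 : ℝ)..δ, a s := by
    rw [intervalIntegral.integral_comp_sub_left, sub_self]
    refine intervalIntegral.integral_mono_interval le_rfl (by linarith) (by linarith [hm.1]) ?_
      (ha 0 δ)
    filter_upwards [ae_restrict_mem measurableSet_Ioc] with s hs using ha0 s hs.1
  have e4 := intervalIntegral.integral_add_adjacent_intervals (hII t₁ 0 m) (hII t₁ m t₁)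
  have e5 := h t₁ ht₁0.le
  have e6 := h m hm0
  nlinarith

/-! ### The kernel of the fractional problem -/

/-- The kernel of the Volterra equation satisfied by the derivative of a solution. -/
noncomputable def relaxationKernel (α κ lam s : ℝ) : ℝ := κ * s ^ (-α) + lam

section Kernel

variable {α κ lam : ℝ}

theorem measurable_relaxationKernel : Measurable (relaxationKernel α κ lam) := by
  unfold relaxationKernel
  fun_prop

/-- The two terms are Gamma integrals with parameters `1 - α` and `1`. -/
theorem integrableOn_exp_mul_relaxationKernel (hα' : α < 1) :
    IntegrableOn (fun s => Real.exp (-s) * relaxationKernel α κ lam s) (Ioi 0) := by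
  have h1 := (Real.GammaIntegral_convergent (s := 1 - α) (by linarith)).const_mul κ
  have h2 := (Real.GammaIntegral_convergent (s := 1) one_pos).const_mul lam
  refine (h1.add h2).congr (Filter.Eventually.of_forall fun s => ?_)
  simp only [relaxationKernel, Pi.add_apply, sub_self, Real.rpow_zero, mul_one,
    show 1 - α - 1 = -α by ring]
  ring

theorem intervalIntegrable_rpow_neg (hα' : α < 1) (x y : ℝ) :
    IntervalIntegrable (fun s : ℝ => s ^ (-α)) volume x y :=
  intervalIntegral.intervalIntegrable_rpow' (by linarith)

theorem intervalIntegrable_relaxationKernel (hα' : α < 1) (x y : ℝ) :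
    IntervalIntegrable (relaxationKernel α κ lam) volume x y :=
  ((intervalIntegrable_rpow_neg hα' x y).const_mul κ).add intervalIntegrable_const

theorem antitoneOn_relaxationKernel (hα : 0 < α) (hκ : 0 < κ) :
    AntitoneOn (relaxationKernel α κ lam) (Ioi 0) := fun x hx y hy hxy => by
  have := Real.antitoneOn_rpow_Ioi_of_exponent_nonpos (neg_nonpos.mpr hα.le) hx hy hxy
  unfold relaxationKernel
  gcongr

theorem relaxationKernel_nonneg (hκ : 0 < κ) (hlam : 0 < lam) {s : ℝ} (hs : 0 < s) :
    0 ≤ relaxationKernel α κ lam s := by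
  unfold relaxationKernel
  positivity

end Kernel

/-! ### Uniqueness and homogeneity -/

/-- Almost everywhere existence of the convolution of two locally integrable functions. -/
theorem ae_intervalIntegrable_volterra {K f : ℝ → ℝ} (hK : Measurable K) (hf : Measurable f)
    {T : ℝ} (hT : 0 ≤ T) (hKi : IntervalIntegrable K volume 0 T)
    (hfi : IntervalIntegrable f volume 0 T) :
    ∀ᵐ t ∂volume.restrict (Ioc 0 T), IntervalIntegrable (fun s => K (t - s) * f s) volume 0 t := by
  have hlt := lintegral_volterra_le hK.enorm hf.enorm T
  rw [intervalIntegrable_iff_integrableOn_Ioc_of_le hT] at hKi hfi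
  have hfin : ∫⁻ t in Ioc 0 T, ∫⁻ s in Ioc 0 t, ‖K (t - s)‖ₑ * ‖f s‖ₑ ≠ ⊤ :=
    ne_top_of_le_ne_top (ENNReal.mul_ne_top hKi.2.ne hfi.2.ne) hlt
  have hmeas : AEMeasurable (fun t => ∫⁻ s in Ioc 0 t, ‖K (t - s)‖ₑ * ‖f s‖ₑ)
      (volume.restrict (Ioc 0 T)) := by
    have : (fun t => ∫⁻ s in Ioc 0 t, ‖K (t - s)‖ₑ * ‖f s‖ₑ) = fun t =>
        ∫⁻ s, {p : ℝ × ℝ | 0 < p.2 ∧ p.2 ≤ p.1}.indicator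
          (fun p => ‖K (p.1 - p.2)‖ₑ * ‖f p.2‖ₑ) (t, s) := by
      ext t
      rw [← lintegral_indicator measurableSet_Ioc]
      rfl
    rw [this]
    refine (Measurable.lintegral_prod_right' ?_).aemeasurable
    refine Measurable.indicator ?_ ((measurableSet_lt measurable_const measurable_snd).inter
      (measurableSet_le measurable_snd measurable_fst))
    exact (hK.comp (measurable_fst.sub measurable_snd)).enorm.mul (hf.comp measurable_snd).enorm
  filter_upwards [ae_lt_top' hmeas hfin, ae_restrict_mem measurableSet_Ioc] with t ht htm
  rw [intervalIntegrable_iff_integrableOn_Ioc_of_le htm.1.le]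
  refine ⟨((hK.comp (measurable_const.sub measurable_id)).mul hf).aestronglyMeasurable, ?_⟩
  simpa only [hasFiniteIntegral_iff_enorm, enorm_mul] using ht

namespace IsFracODESolution

variable {α q₁ lam v₀ : ℝ} {v w : ℝ → ℝ}

/-- Two solutions with the same initial value agree. -/
theorem unique (hα' : α < 1) (hv : IsFracODESolution α q₁ lam v₀ v)
    (hw : IsFracODESolution α q₁ lam v₀ w) {T : ℝ} (hT : 0 < T) : w T = v T := by
  set κ := q₁ * (1 / Real.Gamma (1 - α)) with hκ
  set d : ℝ → ℝ := fun t => deriv w t - deriv v t with hd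
  have md : Measurable d := (measurable_deriv w).sub (measurable_deriv v)
  have mp : Measurable fun s : ℝ => s ^ (-α) := by fun_prop
  have iv := (hv.absCont T hT).intervalIntegrable_deriv
  have iw := (hw.absCont T hT).intervalIntegrable_deriv
  have hdT : ∀ t, 0 < t → ∫ s in (0 : ℝ)..t, d s = w t - v t := by
    intro t ht
    rw [intervalIntegral.integral_sub (hw.absCont t ht).intervalIntegrable_deriv
      (hv.absCont t ht).intervalIntegrable_deriv, (hw.absCont t ht).integral_deriv_eq_sub,
      (hv.absCont t ht).integral_deriv_eq_sub, hv.initial, hw.initial]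
    ring
  have heq : ∀ᵐ t ∂volume.restrict (Ioc 0 T),
      d t = -∫ s in (0 : ℝ)..t, relaxationKernel α κ lam (t - s) * d s := by
    -- Subtracting the two Caputo integrals under one integral sign requires each to converge, which
    -- holds for almost every `t`.
    have rv := ae_intervalIntegrable_volterra mp (measurable_deriv v) hT.le
      (intervalIntegrable_rpow_neg hα' 0 T) iv
    have rw' := ae_intervalIntegrable_volterra mp (measurable_deriv w) hT.le
      (intervalIntegrable_rpow_neg hα' 0 T) iw
    filter_upwards [rv, rw', ae_restrict_of_ae_restrict_of_subset Ioc_subset_Ioi_self hv.equation,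
      ae_restrict_of_ae_restrict_of_subset Ioc_subset_Ioi_self hw.equation,
      ae_restrict_mem measurableSet_Ioc] with t h1 h2 h3 h4 ht
    have hsplit : ∫ s in (0 : ℝ)..t, relaxationKernel α κ lam (t - s) * d s =
        κ * ((∫ s in (0 : ℝ)..t, (t - s) ^ (-α) * deriv w s) -
          ∫ s in (0 : ℝ)..t, (t - s) ^ (-α) * deriv v s) + lam * (w t - v t) := by
      rw [← hdT t ht.1, ← intervalIntegral.integral_sub h2 h1,
        ← intervalIntegral.integral_const_mul, ← intervalIntegral.integral_const_mul,
        ← intervalIntegral.integral_add]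
      · congr 1
        ext s
        simp only [relaxationKernel, hd]
        ring
      · exact (h2.sub h1).const_mul κ
      · exact ((hw.absCont t ht.1).intervalIntegrable_deriv.sub
          (hv.absCont t ht.1).intervalIntegrable_deriv).const_mul lam
    rw [hsplit, hκ]
    unfold caputoDeriv at h3 h4
    simp only [hd]
    linear_combination h4 - h3
  obtain ⟨σ, hσ, hint, hlt⟩ := exists_exp_weight_lt_one
    (integrableOn_exp_mul_relaxationKernel (κ := κ) (lam := lam) hα')
  have hsmall : ∫⁻ s in Ioc 0 T, ENNReal.ofReal (Real.exp (-σ * s)) *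
      ‖relaxationKernel α κ lam s‖ₑ < 1 := by
    refine (lintegral_mono_set (t := Ioi 0) Ioc_subset_Ioi_self).trans_lt ?_
    have : ∀ s, ENNReal.ofReal (Real.exp (-σ * s)) * ‖relaxationKernel α κ lam s‖ₑ =
        ‖Real.exp (-σ * s) * relaxationKernel α κ lam s‖ₑ := fun s => by
      rw [enorm_mul, Real.enorm_eq_ofReal (Real.exp_pos _).le]
    simp_rw [this]
    rw [← ofReal_integral_norm_eq_lintegral_enorm hint]
    exact ENNReal.ofReal_lt_one.mpr hlt
  have hdi : IntegrableOn d (Ioc 0 T) :=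
    (intervalIntegrable_iff_integrableOn_Ioc_of_le hT.le).mp (iw.sub iv)
  have hzero := ae_eq_zero_of_le_volterra (K := fun s => ‖relaxationKernel α κ lam s‖ₑ)
    measurable_relaxationKernel.enorm md.enorm hdi.2.ne hσ hsmall (by
      filter_upwards [heq, ae_restrict_mem measurableSet_Ioc] with t ht htm
      rw [ht, enorm_neg, intervalIntegral.integral_of_le htm.1.le]
      refine (enorm_integral_le_lintegral_enorm _).trans (le_of_eq ?_)
      simp only [enorm_mul])
  have h0 : ∫ s in (0 : ℝ)..T, d s = 0 := by
    rw [intervalIntegral.integral_of_le hT.le]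
    refine integral_eq_zero_of_ae ?_
    filter_upwards [hzero] with t ht
    simpa using ht
  rw [hdT T hT] at h0
  linarith

theorem const_mul (hv : IsFracODESolution α q₁ lam v₀ v) (c : ℝ) :
    IsFracODESolution α q₁ lam (c * v₀) fun t => c * v t where
  absCont T hT := (hv.absCont T hT).const_mul c
  initial := by rw [hv.initial]
  equation := by
    -- Valid at every `t`, even where `v` is not differentiable.
    have hderiv : deriv (fun t => c * v t) = fun t => c * deriv v t := by
      ext t; exact deriv_const_mul_field c
    filter_upwards [hv.equation] with t ht
    have : caputoDeriv α (fun t => c * v t) t = c * caputoDeriv α v t := by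
      unfold caputoDeriv
      simp only [hderiv, mul_left_comm _ c, intervalIntegral.integral_const_mul]
    rw [this, hderiv]
    linear_combination c * ht

end IsFracODESolution

/-! ### The relaxation function and its decay -/

/-- The solution with initial value one: it is nonnegative and nonincreasing, and its negative
derivative `u` solves a Volterra equation. -/
theorem exists_relaxation_solution {α q₁ lam : ℝ} (hα : 0 < α) (hα' : α < 1) (hq₁ : 0 < q₁)
    (hlam : 0 < lam) :
    ∃ u : ℝ → ℝ, Continuous u ∧ (∀ t, 0 ≤ t → 0 < u t) ∧
      (∀ t, 0 ≤ t → u t + q₁ / Real.Gamma (1 - α) * (∫ s in (0 : ℝ)..t, (t - s) ^ (-α) * u s) =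
        lam * (1 - ∫ s in (0 : ℝ)..t, u s)) ∧
      IsFracODESolution α q₁ lam 1 fun t => 1 - ∫ s in (0 : ℝ)..t, u s := by
  set κ := q₁ / Real.Gamma (1 - α) with hκ
  have hκ0 : 0 < κ := div_pos hq₁ (Real.Gamma_pos_of_pos (by linarith))
  obtain ⟨u, hu, heq⟩ := exists_continuous_volterra
    (integrableOn_exp_mul_relaxationKernel (κ := κ) (lam := lam) hα') lam
  have hpos : ∀ t, 0 ≤ t → 0 < u t := fun t ht =>
    volterra_pos (intervalIntegrable_relaxationKernel hα') (antitoneOn_relaxationKernel hα hκ0)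
      (fun s hs => relaxationKernel_nonneg hκ0 hlam hs) hu hlam heq ht
  have heq' : ∀ t, 0 ≤ t → u t + κ * (∫ s in (0 : ℝ)..t, (t - s) ^ (-α) * u s) =
      lam * (1 - ∫ s in (0 : ℝ)..t, u s) := by
    intro t ht
    have h1 := heq t ht
    have h2 : ∫ s in (0 : ℝ)..t, relaxationKernel α κ lam (t - s) * u s =
        κ * (∫ s in (0 : ℝ)..t, (t - s) ^ (-α) * u s) + lam * ∫ s in (0 : ℝ)..t, u s := by
      rw [← intervalIntegral.integral_const_mul, ← intervalIntegral.integral_const_mul,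
        ← intervalIntegral.integral_add]
      · congr 1
        ext s
        simp only [relaxationKernel]
        ring
      · exact (intervalIntegrable_volterra (intervalIntegrable_rpow_neg hα') hu t 0 t).const_mul κ
      · exact (hu.intervalIntegrable 0 t).const_mul lam
    rw [h2] at h1
    linear_combination h1
  refine ⟨u, hu, hpos, heq', ?_, ?_, by simp⟩
  · intro T hT
    have h1 : ContDiff ℝ 1 fun t => 1 - ∫ s in (0 : ℝ)..t, u s := by
      refine contDiff_const.sub (contDiff_one_iff_deriv.mpr ⟨fun t => ?_, ?_⟩)
      · exact (hu.integral_hasStrictDerivAt 0 t).hasDerivAt.differentiableAt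
      · rw [funext (hu.deriv_integral u 0)]
        exact hu
    exact h1.contDiffOn.absolutelyContinuousOnInterval
  · have hderiv : deriv (fun t => 1 - ∫ s in (0 : ℝ)..t, u s) = fun t => -u t := by
      ext t
      rw [deriv_const_sub, hu.deriv_integral]
    filter_upwards [ae_restrict_mem measurableSet_Ioi] with t ht
    unfold caputoDeriv
    rw [hderiv]
    simp only [mul_neg, intervalIntegral.integral_neg]
    have := heq' t (le_of_lt ht)
    rw [hκ] at this
    linear_combination -this

/-- Two-sided power-law bounds for a relaxation function given by its Volterra equation. -/
theorem relaxation_bounds {α κ lam : ℝ} (hα : 0 < α) (hα' : α < 1) (hκ : 0 < κ) (hlam : 0 < lam)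
    {u : ℝ → ℝ} (hu : Continuous u) (hpos : ∀ t, 0 ≤ t → 0 < u t)
    (heq : ∀ t, 0 ≤ t → u t + κ * (∫ s in (0 : ℝ)..t, (t - s) ^ (-α) * u s) =
      lam * (1 - ∫ s in (0 : ℝ)..t, u s)) {t : ℝ} (ht : 0 < t) :
    κ * t ^ (-α) ≤ (lam + κ * t ^ (-α)) * (1 - ∫ s in (0 : ℝ)..t, u s) ∧
      lam * t * (1 - ∫ s in (0 : ℝ)..t, u s) ≤ 1 + κ * (t ^ (1 - α) / (1 - α)) := by
  set V : ℝ → ℝ := fun t => 1 - ∫ s in (0 : ℝ)..t, u s with hV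
  have hVc : Continuous V :=
    continuous_const.sub
      (intervalIntegral.continuous_primitive (fun _ _ => hu.intervalIntegrable _ _) 0)
  have hII := intervalIntegrable_volterra (intervalIntegrable_rpow_neg hα') hu
  have lower : ∀ t, 0 < t → κ * t ^ (-α) ≤ (lam + κ * t ^ (-α)) * V t := by
    intro t ht
    have h1 : t ^ (-α) * ∫ s in (0 : ℝ)..t, u s ≤ ∫ s in (0 : ℝ)..t, (t - s) ^ (-α) * u s := by
      rw [← intervalIntegral.integral_const_mul]
      refine intervalIntegral.integral_mono_on_of_le_Ioo ht.le
        ((hu.intervalIntegrable 0 t).const_mul _) (hII t 0 t) fun s hs => ?_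
      refine mul_le_mul_of_nonneg_right ?_ (hpos s hs.1.le).le
      exact Real.rpow_le_rpow_of_nonpos (sub_pos.mpr hs.2) (by linarith [hs.1]) (by linarith)
    have h2 := heq t ht.le
    have h3 := hpos t ht.le
    have h4 := mul_le_mul_of_nonneg_left h1 hκ.le
    simp only [hV]
    nlinarith
  refine ⟨lower t ht, ?_⟩
  -- Positivity of `V`, hence `∫ u ≤ 1`, comes from the lower bound.
  have hVpos : 0 < V t := by
    have h1 := lower t ht
    have h2 : 0 < κ * t ^ (-α) := by positivity
    exact pos_of_mul_pos_right (h2.trans_le h1) (by positivity)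
  have hu1 : ∫ s in (0 : ℝ)..t, u s ≤ 1 := by simp only [hV] at hVpos; linarith
  -- `G` is the fractional term `κ s^(-α) * u`; in this form its continuity is immediate.
  set G : ℝ → ℝ := fun t => lam * V t - u t with hG
  have hGc : Continuous G := (continuous_const.mul hVc).sub hu
  have hGeq : ∀ s, 0 ≤ s → G s = ∫ τ in (0 : ℝ)..s, κ * (s - τ) ^ (-α) * u τ := by
    intro s hs
    simp only [hG, hV, mul_assoc, intervalIntegral.integral_const_mul]
    linear_combination -heq s hs
  have hk : IntegrableOn (fun s : ℝ => κ * s ^ (-α)) (Ioc 0 t) :=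
    (intervalIntegrable_iff_integrableOn_Ioc_of_le ht.le).mp
      ((intervalIntegrable_rpow_neg hα' 0 t).const_mul κ)
  have hui : IntegrableOn u (Ioc 0 t) := hu.integrableOn_Ioc
  have hGint : ∫ s in (0 : ℝ)..t, G s ≤ κ * (t ^ (1 - α) / (1 - α)) := by
    have h1 : ∫⁻ s in Ioc 0 t, ‖G s‖ₑ ≤
        (∫⁻ s in Ioc 0 t, ‖κ * s ^ (-α)‖ₑ) * ∫⁻ s in Ioc 0 t, ‖u s‖ₑ := by
      refine le_trans (setLIntegral_mono' measurableSet_Ioc fun s hs => ?_)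
        (lintegral_volterra_le (K := fun s => ‖κ * s ^ (-α)‖ₑ) (f := fun s => ‖u s‖ₑ)
          (by fun_prop) hu.measurable.enorm t)
      rw [hGeq s hs.1.le, intervalIntegral.integral_of_le hs.1.le]
      refine (enorm_integral_le_lintegral_enorm _).trans (le_of_eq ?_)
      simp only [enorm_mul]
    rw [← ofReal_integral_norm_eq_lintegral_enorm hGc.integrableOn_Ioc,
      ← ofReal_integral_norm_eq_lintegral_enorm hk, ← ofReal_integral_norm_eq_lintegral_enorm hui,
      ← ENNReal.ofReal_mul (integral_nonneg fun _ => norm_nonneg _),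
      ENNReal.ofReal_le_ofReal_iff (mul_nonneg (integral_nonneg fun _ => norm_nonneg _)
        (integral_nonneg fun _ => norm_nonneg _))] at h1
    have h2 : ∫ s in Ioc 0 t, ‖u s‖ = ∫ s in (0 : ℝ)..t, u s := by
      rw [intervalIntegral.integral_of_le ht.le]
      exact setIntegral_congr_fun measurableSet_Ioc fun s hs =>
        Real.norm_of_nonneg (hpos s hs.1.le).le
    have h3 : ∫ s in Ioc 0 t, ‖κ * s ^ (-α)‖ = κ * (t ^ (1 - α) / (1 - α)) := by
      have e1 : ∫ s in Ioc 0 t, ‖κ * s ^ (-α)‖ = ∫ s in (0 : ℝ)..t, κ * s ^ (-α) := by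
        rw [intervalIntegral.integral_of_le ht.le]
        refine setIntegral_congr_fun measurableSet_Ioc fun s hs => Real.norm_of_nonneg ?_
        have : 0 < s := hs.1
        positivity
      rw [e1, intervalIntegral.integral_const_mul, integral_rpow (Or.inl (by linarith)),
        show -α + 1 = 1 - α by ring, Real.zero_rpow (by linarith), sub_zero]
    rw [h2, h3] at h1
    have h4 : ∫ s in (0 : ℝ)..t, G s ≤ ∫ s in Ioc 0 t, ‖G s‖ := by
      rw [intervalIntegral.integral_of_le ht.le]
      exact (Real.le_norm_self _).trans (norm_integral_le_integral_norm _)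
    have h5 : 0 ≤ κ * (t ^ (1 - α) / (1 - α)) := by
      have : 0 < 1 - α := by linarith
      positivity
    exact h4.trans (h1.trans (mul_le_of_le_one_right h5 hu1))
  have hsum : lam * ∫ s in (0 : ℝ)..t, V s =
      (∫ s in (0 : ℝ)..t, G s) + ∫ s in (0 : ℝ)..t, u s := by
    rw [← intervalIntegral.integral_const_mul,
      ← intervalIntegral.integral_add (hGc.intervalIntegrable _ _) (hu.intervalIntegrable _ _)]
    simp [hG]
  have hVint : t * V t ≤ ∫ s in (0 : ℝ)..t, V s := by
    have : ∫ _ in (0 : ℝ)..t, V t = t * V t := by simp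
    rw [← this]
    refine intervalIntegral.integral_mono_on ht.le intervalIntegrable_const
      (hVc.intervalIntegrable _ _) fun s hs => ?_
    have h1 := intervalIntegral.integral_add_adjacent_intervals
      (hu.intervalIntegrable (μ := volume) 0 s) (hu.intervalIntegrable s t)
    have h2 : 0 ≤ ∫ τ in s..t, u τ :=
      intervalIntegral.integral_nonneg hs.2 fun τ hτ => (hpos τ (hs.1.trans hτ.1)).le
    simp only [hV]
    linarith
  have := mul_le_mul_of_nonneg_left hVint hlam.le
  change lam * t * V t ≤ _
  linarith

/-! ### The main theorem -/

theorem lemmaA1 (α q₁ lam : ℝ) (hα : 0 < α) (hα' : α < 1) (hq₁ : 0 < q₁) (hlam : 0 < lam) :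
    (∀ v₀ : ℝ, ∃ v : ℝ → ℝ, IsFracODESolution α q₁ lam v₀ v ∧
      ∀ w : ℝ → ℝ, IsFracODESolution α q₁ lam v₀ w → ∀ t : ℝ, 0 ≤ t → w t = v t) ∧
    ∀ t₀ : ℝ, 0 < t₀ → ∃ c C : ℝ, 0 < c ∧ 0 < C ∧
      ∀ (v₀ : ℝ) (v : ℝ → ℝ), IsFracODESolution α q₁ lam v₀ v →
        ∀ t : ℝ, t₀ ≤ t →
          c * |v₀| * t ^ (-α) ≤ |v t| ∧ |v t| ≤ C * |v₀| * t ^ (-α) := by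
  obtain ⟨u, hu, hpos, heq, hsol⟩ := exists_relaxation_solution hα hα' hq₁ hlam
  set V : ℝ → ℝ := fun t => 1 - ∫ s in (0 : ℝ)..t, u s with hV
  have hscaled : ∀ v₀, IsFracODESolution α q₁ lam v₀ fun t => v₀ * V t := fun v₀ => by
    simpa using hsol.const_mul v₀
  refine ⟨fun v₀ => ⟨_, hscaled v₀, fun w hw t ht => ?_⟩, fun t₀ ht₀ => ?_⟩
  · rcases ht.eq_or_lt with rfl | h
    · rw [hw.initial, (hscaled v₀).initial]
    · exact (hscaled v₀).unique hα' hw h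
  set κ := q₁ / Real.Gamma (1 - α) with hκ
  have hκ0 : 0 < κ := div_pos hq₁ (Real.Gamma_pos_of_pos (by linarith))
  have h1α : 0 < 1 - α := by linarith
  -- For `c`, replace `t^(-α)` by `t₀^(-α)` in the denominator of the lower bound. For `C`, divide
  -- the upper bound by `lam t` and use `t⁻¹ = t^(α - 1) t^(-α) ≤ t₀^(α - 1) t^(-α)`.
  refine ⟨κ / (lam + κ * t₀ ^ (-α)), (t₀ ^ (α - 1) + κ / (1 - α)) / lam, by positivity,
    by positivity, fun v₀ v hv t ht => ?_⟩
  have ht0 : 0 < t := ht₀.trans_le ht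
  obtain ⟨hl, hup⟩ := relaxation_bounds hα hα' hκ0 hlam hu hpos heq ht0
  change κ * t ^ (-α) ≤ (lam + κ * t ^ (-α)) * V t at hl
  change lam * t * V t ≤ _ at hup
  have hx : 0 < t ^ (-α) := by positivity
  have hVpos : 0 < V t :=
    pos_of_mul_pos_right (lt_of_lt_of_le (by positivity) hl) (by positivity)
  have hmono : t ^ (-α) ≤ t₀ ^ (-α) := Real.rpow_le_rpow_of_nonpos ht₀ ht (by linarith)
  have hmono' : t ^ (α - 1) ≤ t₀ ^ (α - 1) := Real.rpow_le_rpow_of_nonpos ht₀ ht (by linarith)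
  have lowerV : κ / (lam + κ * t₀ ^ (-α)) * t ^ (-α) ≤ V t := by
    rw [div_mul_eq_mul_div, div_le_iff₀ (by positivity)]
    nlinarith [mul_le_mul_of_nonneg_left hmono (mul_pos hκ0 hVpos).le]
  have upperV : V t ≤ (t₀ ^ (α - 1) + κ / (1 - α)) / lam * t ^ (-α) := by
    have e1 : t ^ (1 - α) = t * t ^ (-α) := by
      rw [show 1 - α = 1 + -α by ring, Real.rpow_add ht0, Real.rpow_one]
    have e2 : t * (t ^ (α - 1) * t ^ (-α)) = 1 := by
      rw [← Real.rpow_add ht0, show α - 1 + -α = -1 by ring, Real.rpow_neg_one,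
        mul_inv_cancel₀ ht0.ne']
    rw [div_mul_eq_mul_div, le_div_iff₀ hlam]
    refine le_of_mul_le_mul_left ?_ ht0
    have e3 : t ^ (α - 1) * t ^ (-α) ≤ t₀ ^ (α - 1) * t ^ (-α) := by gcongr
    have e4 := mul_le_mul_of_nonneg_left e3 ht0.le
    rw [e1] at hup
    calc t * (V t * lam) = lam * t * V t := by ring
      _ ≤ 1 + κ * (t * t ^ (-α) / (1 - α)) := hup
      _ ≤ t * (t₀ ^ (α - 1) * t ^ (-α)) + κ * (t * t ^ (-α) / (1 - α)) := by linarith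
      _ = t * ((t₀ ^ (α - 1) + κ / (1 - α)) * t ^ (-α)) := by ring
  rw [(hscaled v₀).unique hα' hv ht0, abs_mul, abs_of_pos hVpos]
  constructor
  · calc _ = |v₀| * (κ / (lam + κ * t₀ ^ (-α)) * t ^ (-α)) := by ring
      _ ≤ _ := by gcongr
  · calc _ ≤ |v₀| * ((t₀ ^ (α - 1) + κ / (1 - α)) / lam * t ^ (-α)) := by gcongr
      _ = _ := by ring
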